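/- Let $X$ be a set of inputs, let $f(\theta;x)$ be a real-valued model with parameters $\theta\in\mathbb{R}^D$ and inputs $x\in X$, and let $L\in\mathbb{R}$. Assume that for every $x\in X$ the function $\theta\mapsto f(\theta;x)$ is $\mathcal{C}^2$ on $\mathbb{R}^D$ and $L$-homogeneous, i.e. $f(c\theta;x)=c^Lf(\theta;x)$ for all $c>0$ and all $\theta$. Let $(x_1,y_1),\dots,(x_n,y_n)\in X\times\mathbb{R}$ with $n\ge 1$, and let $\bar\theta_{\mathrm{init}}\in\mathbb{R}^D$ satisfy $f(\bar\theta_{\mathrm{init}};x)=0$ for all $x\in X$. Assume that the NTK features $\nabla f(\bar\theta_{\mathrm{init}};x_i)$, $i=1,\dots,n$ (gradients with respect to $\theta$), are linearly independent. Let $\lambda(\alpha)>0$ for $\alpha>0$, with $\lambda(\alpha)=\Theta(\alpha^{-p})$ as $\alpha\to+\infty$ for some constant $p>0$. For $\lambda>0$ put $$\mathcal{L}_{\lambda}(\theta)=\frac1n\sum_{i=1}^n\bigl(f(\theta;x_i)-y_i\bigr)^2+\frac{\lambda}{2}\|\theta\|_2^2 .$$ Then: 1. The problem of minimizing $\frac12\|h\|_2^2$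 over $h\in\mathbb{R}^D$ subject to $\langle\nabla f(\bar\theta_{\mathrm{init}};x_i),h\rangle=y_i$ for all $i$ has a unique solution $h^*_{\mathrm{ntk}}$. 2. For every $\alpha>0$ the gradient flow $\frac{\mathrm d\theta}{\mathrm dt}=-\nabla\mathcal{L}_{\lambda(\alpha)}(\theta)$ with $\theta(0)=\alpha\bar\theta_{\mathrm{init}}$ has a solution on $[0,\infty)$. 3. Let $\theta(t;\alpha\bar\theta_{\mathrm{init}})$ denote any such solution. For every constant $c\in(0,1)$, with $T_c^-(\alpha):=\frac{1-c}{\lambda(\alpha)}\log\alpha$, for every $x\in X$, $$\lim_{\alpha\to+\infty} f\bigl(\theta(T_c^-(\alpha);\alpha\bar\theta_{\mathrm{init}});x\bigr)=\bigl\langle\nabla f(\bar\theta_{\mathrm{init}};x),h^*_{\mathrm{ntk}}\bigr\rangle .$$ -/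

import Mathlib

open Filter Topology Asymptotics

noncomputable section

/-- Squared loss `ℓ(ŷ; y) = (ŷ - y)²`. -/
def squaredLoss (yhat y : ℝ) : ℝ := (yhat - y) ^ 2

/-- Training loss `𝓛(θ) = (1/n) ∑ᵢ ℓ(f(θ; xᵢ); yᵢ)` for the squared loss. -/
def trainLoss {D n : ℕ} {X : Type*} (f : EuclideanSpace ℝ (Fin D) → X → ℝ)
    (x : Fin n → X) (y : Fin n → ℝ) (θ : EuclideanSpace ℝ (Fin D)) : ℝ :=
  (1 / (n : ℝ)) * ∑ i, squaredLoss (f θ (x i)) (y i)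

/-- Training loss with weight decay `𝓛_lam(θ) = 𝓛(θ) + (lam/2) ‖θ‖²`. -/
def regLoss {D n : ℕ} {X : Type*} (f : EuclideanSpace ℝ (Fin D) → X → ℝ)
    (x : Fin n → X) (y : Fin n → ℝ) (lam : ℝ) (θ : EuclideanSpace ℝ (Fin D)) : ℝ :=
  trainLoss f x y θ + lam / 2 * ‖θ‖ ^ 2

/-- The model is `L`-homogeneous in its parameters: `f(c θ; x) = c ^ L f(θ; x)` for `c > 0`. -/
def IsHomogeneousModel {D : ℕ} {X : Type*} (f : EuclideanSpace ℝ (Fin D) → X → ℝ)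
    (L : ℝ) : Prop :=
  ∀ (x : X) (c : ℝ), 0 < c → ∀ θ : EuclideanSpace ℝ (Fin D), f (c • θ) x = c ^ L * f θ x

/-- NTK feature `∇f(θ; x)` of the input `x`: the gradient in the parameters at `θ`. -/
def ntkFeature {D : ℕ} {X : Type*} (f : EuclideanSpace ℝ (Fin D) → X → ℝ)
    (θ : EuclideanSpace ℝ (Fin D)) (x : X) : EuclideanSpace ℝ (Fin D) :=
  gradient (fun ϑ => f ϑ x) θ

/-- `θ` solves `dθ/dt = -∇F(θ)` on `[0, ∞)` with `θ(0) = θ₀`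
(the derivative is one-sided at time `0` and two-sided at positive times). -/
def IsGradientFlow {D : ℕ} (F : EuclideanSpace ℝ (Fin D) → ℝ)
    (θ₀ : EuclideanSpace ℝ (Fin D)) (θ : ℝ → EuclideanSpace ℝ (Fin D)) : Prop :=
  θ 0 = θ₀ ∧ ∀ t : ℝ, 0 ≤ t → HasDerivWithinAt θ (-gradient F (θ t)) (Set.Ici 0) t

/-- `h` solves: minimize `½ ‖h‖²` subject to `⟨g i, h⟩ = y i` for all `i`. -/
def IsMinNormInterpolant {D n : ℕ} (g : Fin n → EuclideanSpace ℝ (Fin D))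
    (y : Fin n → ℝ) (h : EuclideanSpace ℝ (Fin D)) : Prop :=
  (∀ i, inner ℝ (g i) h = y i) ∧
    ∀ h' : EuclideanSpace ℝ (Fin D), (∀ i, inner ℝ (g i) h' = y i) →
      1 / 2 * ‖h‖ ^ 2 ≤ 1 / 2 * ‖h'‖ ^ 2

end

/-! Write `b = α e^{-lam t}` and `φ = θ / b`. In the variable `φ` the weight decay disappears, and
by homogeneity `φ' = -(2/n) b^(L-2) ∑ rᵢ ∇f(φ; xᵢ)`, with `r` the residual vector. Some feature is
nonzero, so continuity of the gradient at `0` forces `L ≥ 1` (`IsHomogeneousModel.one_le`).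

While `φ` stays near `θinit` the features remain well conditioned. The squared residual is then
damped at rate `b^(2L-2)` against a forcing of size `lam`, so the residual is a decaying exponential
plus `O(lam)` (`le_of_hasDerivAt_sq_le`). Integrating the speed gives `‖φ - θinit‖ = O(b^(-L))`
(`norm_le_of_norm_deriv_le`), and a continuity argument closes the loop as long as this is small
(`rescaled_gradientFlow_bounds`).

At the chosen time `b = α^c → ∞`, so `φ → θinit`, while `u = b^L (φ - θinit)` stays bounded. Since
`f(θinit) = 0`, the first-order expansion gives `f(θ; z) = b^L f(φ; z) = ⟨∇f(θinit; z), u⟩ + o(1)`.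
The vanishing residual forces `⟨∇f(θinit; xᵢ), u⟩ → yᵢ`; the velocity of `φ` lies almost in the span
of the initial features, so the part of `u` orthogonal to that span vanishes. These two facts
characterize the minimum norm interpolant as the limit of `u`. -/

/-! ### Global existence of gradient flows. -/

/-- A bounded Lipschitz vector field has integral curves defined for all times. -/
theorem exists_global_integralCurve_of_lipschitz_of_bounded {E : Type*} [NormedAddCommGroup E]
    [NormedSpace ℝ E] [CompleteSpace E] {v : E → E} {K M : NNReal} (hK : LipschitzWith K v)
    (hM : ∀ z, ‖v z‖ ≤ M) (z₀ : E) :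
    ∃ γ : ℝ → E, γ 0 = z₀ ∧ ∀ t, HasDerivAt γ (v (γ t)) t := by
  have hloc : ∀ a : NNReal, ∃ γ : ℝ → E, γ 0 = z₀ ∧
      ∀ t ∈ Set.Ioo (-(a : ℝ)) a, HasDerivAt γ (v (γ t)) t := by
    intro a
    have h0 : (0 : ℝ) ∈ Set.Icc (-(a : ℝ)) a := ⟨by simp, a.2⟩
    -- A curve of speed at most `M` travels at most `M * a` in time `a`, so a ball of that radius
    -- puts no restriction on `a`.
    have hpl : IsPicardLindelof (fun _ => v) (⟨0, h0⟩ : Set.Icc (-(a : ℝ)) a) z₀ (M * a) 0 M K :=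
      { lipschitzOnWith := fun _ _ => hK.lipschitzOnWith
        continuousOn := fun _ _ => continuousOn_const
        norm_le := fun _ _ z _ => hM z
        mul_max_le := by simp }
    obtain ⟨γ, h1, h2⟩ := hpl.exists_eq_forall_mem_Icc_hasDerivWithinAt₀
    exact ⟨γ, h1, fun t ht =>
      (h2 t (Set.Ioo_subset_Icc_self ht)).hasDerivAt (Icc_mem_nhds ht.1 ht.2)⟩
  choose γ hγ0 hγ using hloc
  have huniq : ∀ {a b : NNReal}, 0 < a → a ≤ b →
      Set.EqOn (γ a) (γ b) (Set.Ioo (-(a : ℝ)) a) := by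
    intro a b ha hab
    have hab' : (a : ℝ) ≤ b := by exact_mod_cast hab
    have ha' : (0 : ℝ) < a := by exact_mod_cast ha
    exact ODE_solution_unique_of_mem_Ioo (v := fun _ => v) (s := fun _ => Set.univ) (t₀ := 0)
      (fun _ _ => hK.lipschitzOnWith) ⟨by linarith, ha'⟩
      (fun t ht => ⟨hγ a t ht, trivial⟩)
      (fun t ht => ⟨hγ b t ⟨by linarith [ht.1], by linarith [ht.2]⟩, trivial⟩)
      (by rw [hγ0, hγ0])
  let R : ℝ → NNReal := fun t => ⟨|t| + 1, by positivity⟩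
  have hR : ∀ t, (R t : ℝ) = |t| + 1 := fun t => rfl
  refine ⟨fun t => γ (R t) t, hγ0 _, fun t => ?_⟩
  have ht : t ∈ Set.Ioo (-(R t : ℝ)) (R t) := by
    rw [Set.mem_Ioo, ← abs_lt, hR]; exact lt_add_one _
  refine (hγ (R t) t ht).congr_of_eventuallyEq ?_
  filter_upwards [Ioo_mem_nhds ht.1 ht.2] with s hs
  have hs' : s ∈ Set.Ioo (-(R s : ℝ)) (R s) := by
    rw [Set.mem_Ioo, ← abs_lt, hR]; exact lt_add_one _
  have hpos : ∀ u, 0 < R u := fun u => by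
    rw [← NNReal.coe_pos, hR]; positivity
  rcases le_total (R s) (R t) with h | h
  · exact huniq (hpos s) h hs'
  · exact (huniq (hpos t) h hs).symm

/-- The negative gradient flow of a `C²` function with bounded sublevel sets exists for all
nonnegative times. -/
theorem exists_gradientFlow_of_bounded_sublevel {D : ℕ} {F : EuclideanSpace ℝ (Fin D) → ℝ}
    (hF : ContDiff ℝ 2 F) (z₀ : EuclideanSpace ℝ (Fin D)) {R : ℝ} (hR : 0 < R)
    (hsub : ∀ z, F z ≤ F z₀ → ‖z‖ ≤ R) :
    ∃ θ : ℝ → EuclideanSpace ℝ (Fin D), IsGradientFlow F z₀ θ := by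
  have hgrad : ContDiff ℝ 1 (gradient F) := by
    have h : ContDiff ℝ 1 (fderiv ℝ F) := hF.fderiv_right (by norm_num)
    exact (InnerProductSpace.toDual ℝ
      (EuclideanSpace ℝ (Fin D))).symm.toContinuousLinearEquiv.contDiff.comp h
  -- The cutoff makes the field bounded and Lipschitz. `F` still decreases along the modified flow,
  -- so the curve stays where `χ = 1` and solves the original equation.
  let χ : ContDiffBump (0 : EuclideanSpace ℝ (Fin D)) := ⟨R, R + 1, hR, by linarith⟩
  let v : EuclideanSpace ℝ (Fin D) → EuclideanSpace ℝ (Fin D) := fun z => χ z • -gradient F z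
  have hv : ContDiff ℝ 1 v := χ.contDiff.smul hgrad.neg
  have hvc : HasCompactSupport v := χ.hasCompactSupport.smul_right
  obtain ⟨K, hK⟩ := ContDiff.lipschitzWith_of_hasCompactSupport hvc hv (by norm_num)
  obtain ⟨M, hM⟩ := hvc.exists_bound_of_continuous hv.continuous
  obtain ⟨γ, hγ0, hγ⟩ := exists_global_integralCurve_of_lipschitz_of_bounded hK
    (M := ⟨max M 0, le_max_right _ _⟩) (fun z => (hM z).trans (le_max_left _ _)) z₀
  have hFγ : ∀ t, HasDerivAt (fun s => F (γ s)) (-(χ (γ t) * ‖gradient F (γ t)‖ ^ 2)) t := by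
    intro t
    have h1 : HasGradientAt F (gradient F (γ t)) (γ t) :=
      ((hF.differentiable (by norm_num)) _).hasGradientAt
    have h2 := h1.hasFDerivAt.comp_hasDerivAt t (hγ t)
    refine h2.congr_deriv ?_
    rw [InnerProductSpace.toDual_apply_apply, inner_smul_right, inner_neg_right,
      real_inner_self_eq_norm_sq, mul_neg]
  have hanti : Antitone fun s => F (γ s) := by
    refine antitone_of_deriv_nonpos (fun t => (hFγ t).differentiableAt) fun t => ?_
    rw [(hFγ t).deriv]
    have := χ.nonneg (x := γ t)
    have : 0 ≤ χ (γ t) * ‖gradient F (γ t)‖ ^ 2 := by positivity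
    linarith
  refine ⟨γ, hγ0, fun t ht => ?_⟩
  have h1 : ‖γ t‖ ≤ R := hsub _ (by simpa [hγ0] using hanti ht)
  have h2 : χ (γ t) = 1 := χ.one_of_mem_closedBall (by simpa [χ] using h1)
  have h3 := (hγ t).hasDerivWithinAt (s := Set.Ici 0)
  simpa [v, h2] using h3


/-! ### The regularized loss and homogeneity of the features. -/

section HomogeneousModel

variable {D n : ℕ} {X : Type*}

theorem regLoss_contDiff {f : EuclideanSpace ℝ (Fin D) → X → ℝ}
    (hsmooth : ∀ x : X, ContDiff ℝ 2 (fun θ => f θ x)) (x : Fin n → X) (y : Fin n → ℝ) (lam : ℝ) :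
    ContDiff ℝ 2 (regLoss f x y lam) := by
  unfold regLoss trainLoss squaredLoss
  refine ContDiff.add (contDiff_const.mul (ContDiff.sum fun i _ => ?_))
    (contDiff_const.mul (contDiff_norm_sq ℝ))
  exact ((hsmooth (x i)).sub contDiff_const).pow 2

theorem norm_sq_le_regLoss (f : EuclideanSpace ℝ (Fin D) → X → ℝ) (x : Fin n → X) (y : Fin n → ℝ)
    (lam : ℝ) (θ : EuclideanSpace ℝ (Fin D)) : lam / 2 * ‖θ‖ ^ 2 ≤ regLoss f x y lam θ := by
  unfold regLoss trainLoss squaredLoss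
  have : 0 ≤ 1 / (n : ℝ) * ∑ i, (f θ (x i) - y i) ^ 2 := by positivity
  linarith

theorem exists_gradientFlow_regLoss {f : EuclideanSpace ℝ (Fin D) → X → ℝ}
    (hsmooth : ∀ x : X, ContDiff ℝ 2 (fun θ => f θ x)) (x : Fin n → X) (y : Fin n → ℝ) {lam : ℝ}
    (hlam : 0 < lam) (θ₀ : EuclideanSpace ℝ (Fin D)) :
    ∃ θ : ℝ → EuclideanSpace ℝ (Fin D), IsGradientFlow (regLoss f x y lam) θ₀ θ := by
  set C := regLoss f x y lam θ₀
  have hC : 0 ≤ C := le_trans (by positivity) (norm_sq_le_regLoss f x y lam θ₀)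
  -- The `+ 1` keeps the radius positive when `C = 0`.
  refine exists_gradientFlow_of_bounded_sublevel (regLoss_contDiff hsmooth x y lam) θ₀
    (R := Real.sqrt (2 * C / lam) + 1) (by positivity) fun z hz => ?_
  have h1 := (norm_sq_le_regLoss f x y lam z).trans hz
  have h2 : ‖z‖ ^ 2 ≤ 2 * C / lam := by
    rw [le_div_iff₀ hlam]; linarith
  have := Real.le_sqrt_of_sq_le h2
  linarith

theorem gradient_regLoss {f : EuclideanSpace ℝ (Fin D) → X → ℝ}
    (hdiff : ∀ x : X, Differentiable ℝ (fun θ => f θ x)) (x : Fin n → X) (y : Fin n → ℝ)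
    (lam : ℝ) (θ : EuclideanSpace ℝ (Fin D)) :
    gradient (regLoss f x y lam) θ =
      (2 / (n : ℝ)) • ∑ i, (f θ (x i) - y i) • ntkFeature f θ (x i) + lam • θ := by
  apply HasGradientAt.gradient
  rw [hasGradientAt_iff_hasFDerivAt]
  have h1 : ∀ i, HasFDerivAt (fun θ => (f θ (x i) - y i) ^ 2)
      ((2 * (f θ (x i) - y i)) • InnerProductSpace.toDual ℝ _ (ntkFeature f θ (x i))) θ := by
    intro i
    have h := (hdiff (x i) θ).hasGradientAt.hasFDerivAt.sub_const (y i)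
    simpa [ntkFeature] using h.pow 2
  have h2 := (HasFDerivAt.fun_sum fun i (_ : i ∈ Finset.univ) => h1 i).const_mul (1 / (n : ℝ))
  have h3 := ((hasStrictFDerivAt_norm_sq θ).hasFDerivAt).const_mul (lam / 2)
  refine (h2.add h3).congr_fderiv ?_
  ext w
  simp only [add_apply, smul_apply,
    sum_apply, InnerProductSpace.toDual_apply_apply, smul_eq_mul,
    inner_add_left, real_inner_smul_left, sum_inner, Finset.mul_sum, innerSL_apply_apply]
  refine congrArg₂ (· + ·) (Finset.sum_congr rfl fun i _ => by ring) (by simp; ring)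

/-- The features of an `L`-homogeneous model are `(L - 1)`-homogeneous. -/
theorem IsHomogeneousModel.ntkFeature_smul {f : EuclideanSpace ℝ (Fin D) → X → ℝ} {L : ℝ}
    (hhom : IsHomogeneousModel f L) (hdiff : ∀ x : X, Differentiable ℝ (fun θ => f θ x))
    {c : ℝ} (hc : 0 < c) (θ : EuclideanSpace ℝ (Fin D)) (x : X) :
    ntkFeature f (c • θ) x = c ^ (L - 1) • ntkFeature f θ x := by
  have h1 := (hdiff x θ).hasGradientAt.hasFDerivAt.const_mul (c ^ L)
  have h2 : HasFDerivAt (fun ϑ => f (c • ϑ) x) _ θ :=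
    (hdiff x (c • θ)).hasGradientAt.hasFDerivAt.comp θ ((hasFDerivAt_id θ).const_smul c)
  have h3 : (fun ϑ => f (c • ϑ) x) = fun ϑ => c ^ L * f ϑ x := funext fun ϑ => hhom x c hc ϑ
  rw [h3] at h2
  have h4 := h1.unique h2
  refine ext_inner_right ℝ fun w => ?_
  have h5 := DFunLike.congr_fun h4 w
  simp only [smul_apply, ContinuousLinearMap.comp_apply,
    ContinuousLinearMap.id_apply, InnerProductSpace.toDual_apply_apply, smul_eq_mul,
    inner_smul_right] at h5
  unfold ntkFeature
  rw [real_inner_smul_left, Real.rpow_sub_one hc.ne', div_mul_eq_mul_div, h5]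
  field_simp

theorem continuous_ntkFeature {f : EuclideanSpace ℝ (Fin D) → X → ℝ}
    (hsmooth : ∀ x : X, ContDiff ℝ 2 (fun θ => f θ x)) (x : X) :
    Continuous fun θ => ntkFeature f θ x :=
  (InnerProductSpace.toDual ℝ (EuclideanSpace ℝ (Fin D))).symm.continuous.comp
    ((hsmooth x).continuous_fderiv (by norm_num))

/-- A `C¹` homogeneous function with a nonzero gradient somewhere has degree at least one. -/
theorem IsHomogeneousModel.one_le {f : EuclideanSpace ℝ (Fin D) → X → ℝ} {L : ℝ}
    (hhom : IsHomogeneousModel f L) (hsmooth : ∀ x : X, ContDiff ℝ 2 (fun θ => f θ x))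
    {θ : EuclideanSpace ℝ (Fin D)} {x : X} (hne : ntkFeature f θ x ≠ 0) : 1 ≤ L := by
  by_contra! hL
  have hdiff : ∀ x : X, Differentiable ℝ (fun θ => f θ x) :=
    fun x => (hsmooth x).differentiable (by norm_num)
  -- As `c → 0⁺`, continuity gives `‖∇f(cθ)‖` a finite limit, whereas homogeneity with `L < 1` makes
  -- it blow up.
  have h1 : Tendsto (fun c : ℝ => ‖ntkFeature f (c • θ) x‖) (𝓝[>] 0)
      (𝓝 ‖ntkFeature f ((0 : ℝ) • θ) x‖) :=
    ((((continuous_ntkFeature hsmooth x).comp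
      (continuous_id.smul continuous_const)).norm).tendsto (0 : ℝ)).mono_left nhdsWithin_le_nhds
  have h2 : Tendsto (fun c : ℝ => c ^ (L - 1) * ‖ntkFeature f θ x‖) (𝓝[>] 0) atTop :=
    (tendsto_rpow_neg_nhdsGT_zero (by linarith)).atTop_mul_const (norm_pos_iff.2 hne)
  refine not_tendsto_nhds_of_tendsto_atTop h2 _ (h1.congr' ?_)
  filter_upwards [self_mem_nhdsWithin] with c hc
  rw [hhom.ntkFeature_smul hdiff hc, norm_smul, Real.norm_of_nonneg (Real.rpow_nonneg hc.out.le _)]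

/-! ### Minimum norm interpolation. -/

theorem inner_eq_zero_of_mem_span_range {V ι : Type*} [NormedAddCommGroup V]
    [InnerProductSpace ℝ V] {g : ι → V} {v w : V} (hv : v ∈ Submodule.span ℝ (Set.range g))
    (hw : ∀ i, inner ℝ (g i) w = 0) : inner ℝ v w = 0 := by
  induction hv using Submodule.span_induction with
  | mem x hx => obtain ⟨i, rfl⟩ := hx; exact hw i
  | zero => simp
  | add a b _ _ ha hb => rw [inner_add_left, ha, hb, add_zero]
  | smul c a _ ha => rw [real_inner_smul_left, ha, mul_zero]

/-- The vector with prescribed inner products against independent vectors, inside their span. -/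
theorem exists_mem_span_forall_inner_eq {V : Type*} [NormedAddCommGroup V]
    [InnerProductSpace ℝ V] {g : Fin n → V} (hg : LinearIndependent ℝ g) (y : Fin n → ℝ) :
    ∃ h ∈ Submodule.span ℝ (Set.range g), ∀ i, inner ℝ (g i) h = y i := by
  set S := Submodule.span ℝ (Set.range g)
  have : FiniteDimensional ℝ S := FiniteDimensional.span_of_finite ℝ (Set.finite_range g)
  let Λ : S →ₗ[ℝ] (Fin n → ℝ) :=
    LinearMap.pi fun i => (innerSL ℝ (g i)).toLinearMap ∘ₗ S.subtype
  have hinj : Function.Injective Λ := by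
    rw [← LinearMap.ker_eq_bot, LinearMap.ker_eq_bot']
    intro w hw
    have h1 : ∀ i, inner ℝ (g i) (w : V) = 0 := fun i => congrFun hw i
    exact Subtype.ext (inner_self_eq_zero.1 (inner_eq_zero_of_mem_span_range w.2 h1))
  have hdim : Module.finrank ℝ S = Module.finrank ℝ (Fin n → ℝ) := by
    rw [finrank_span_eq_card hg, Module.finrank_fin_fun, Fintype.card_fin]
  obtain ⟨w, hw⟩ := (LinearMap.injective_iff_surjective_of_finrank_eq_finrank hdim).1 hinj y
  exact ⟨w, w.2, fun i => congrFun hw i⟩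

/-- The minimum norm interpolant exists, is unique, and lies in the span of the features. -/
theorem exists_isMinNormInterpolant {g : Fin n → EuclideanSpace ℝ (Fin D)}
    (hg : LinearIndependent ℝ g) (y : Fin n → ℝ) :
    ∃ h ∈ Submodule.span ℝ (Set.range g), IsMinNormInterpolant g y h ∧
      ∀ h', IsMinNormInterpolant g y h' → h' = h := by
  obtain ⟨h, hS, hy⟩ := exists_mem_span_forall_inner_eq hg y
  -- Pythagoras: two interpolants differ by a vector orthogonal to the span, which contains `h`.
  -- Minimality and uniqueness both follow.
  have key : ∀ h', (∀ i, inner ℝ (g i) h' = y i) → ‖h'‖ ^ 2 = ‖h‖ ^ 2 + ‖h' - h‖ ^ 2 := by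
    intro h' hy'
    have h1 : inner ℝ h (h' - h) = 0 :=
      inner_eq_zero_of_mem_span_range hS fun i => by rw [inner_sub_right, hy, hy', sub_self]
    have h2 := norm_add_sq_real h (h' - h)
    rw [h1, add_sub_cancel] at h2
    linarith
  refine ⟨h, hS, ⟨hy, fun h' hy' => ?_⟩, fun h' hh' => ?_⟩
  · have := key h' hy'
    nlinarith [sq_nonneg ‖h' - h‖]
  · have h1 := key h' hh'.1
    have h2 := hh'.2 h hy
    have h3 : ‖h' - h‖ ^ 2 = 0 := le_antisymm (by linarith) (sq_nonneg _)
    exact sub_eq_zero.1 (norm_eq_zero.1 (pow_eq_zero_iff two_ne_zero |>.1 h3))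

/-! ### Scalar comparison estimates and the continuity argument. -/

/-- Since `b' = -lam b`, every power of `b` is differentiated by a constant factor; all weights in
the estimates are such powers. -/
theorem hasDerivAt_const_mul_exp_rpow {α : ℝ} (hα : 0 < α) (lam s t : ℝ) :
    HasDerivAt (fun t => (α * Real.exp (-(lam * t))) ^ s)
      (-(lam * s) * (α * Real.exp (-(lam * t))) ^ s) t := by
  have hpos : 0 < α * Real.exp (-(lam * t)) := by positivity
  have h1 : HasDerivAt (fun t => α * Real.exp (-(lam * t)))
      (-lam * (α * Real.exp (-(lam * t)))) t := by
    have := (((hasDerivAt_id t).const_mul lam).neg.exp).const_mul α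
    refine this.congr_deriv ?_
    simp only [id]
    simp
    ring
  refine (h1.rpow_const (p := s) (Or.inl hpos.ne')).congr_deriv ?_
  rw [Real.rpow_sub_one hpos.ne']
  field_simp

/-- A comparison estimate for `ρ` with `(ρ²)' ≤ -2 k B ρ² + 2 lam L Y ρ`, where
`B = (α e^{-lam t})^(2 L - 2)`. -/
theorem le_of_hasDerivAt_sq_le {L lam α k Y T : ℝ} (hL : 1 ≤ L) (hlam : 0 < lam) (hα : 0 < α)
    (hk : 0 < k) (hY : 0 ≤ Y) {I ρ E' : ℝ → ℝ} (hI0 : I 0 = 0)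
    (hI : ∀ t, HasDerivAt I ((α * Real.exp (-(lam * t))) ^ (2 * L - 2)) t)
    (hρ0 : ρ 0 ≤ Y) (hρ : ∀ t, 0 ≤ ρ t) (hcont : ContinuousOn ρ (Set.Icc 0 T))
    (hderiv : ∀ t ∈ Set.Ioo 0 T, HasDerivAt (fun t => ρ t ^ 2) (E' t) t)
    (hE' : ∀ t ∈ Set.Ioo 0 T, E' t ≤
      -(2 * k * (α * Real.exp (-(lam * t))) ^ (2 * L - 2)) * ρ t ^ 2 + 2 * (lam * L * Y) * ρ t)
    {t : ℝ} (ht : t ∈ Set.Icc 0 T) :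
    ρ t ≤ Y * Real.exp (-(k / 2) * I t) +
      L * Y / k * lam * (α * Real.exp (-(lam * t))) ^ (-(2 * L - 2)) := by
  set b : ℝ → ℝ := fun t => α * Real.exp (-(lam * t)) with hb
  have hpos : ∀ t, 0 < b t := fun t => by positivity
  let c := L * Y / k * lam
  have hc : 0 ≤ c := by positivity
  -- `W` is the square of `c / B`, the value of `ρ` at which damping `k B ρ` balances forcing `lam L
  -- Y`. It is nondecreasing because `b` decreases and `L ≥ 1`.
  let W : ℝ → ℝ := fun t => c ^ 2 * (b t) ^ (-(2 * (2 * L - 2)))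
  have hW : ∀ t, HasDerivAt W (c ^ 2 * (-(lam * (-(2 * (2 * L - 2)))) *
      (b t) ^ (-(2 * (2 * L - 2))))) t :=
    fun t => (hasDerivAt_const_mul_exp_rpow hα lam _ t).const_mul _
  -- Only half of the damping rate `2 k B` goes into the integrating factor; the other half
  -- completes the square in `h4`. Working with `ρ ^ 2` avoids differentiating `ρ` at its zeros.
  let G : ℝ → ℝ := fun t => Real.exp (k * I t) * (ρ t ^ 2 - W t)
  have hIc : Continuous I := continuous_iff_continuousAt.2 fun t => (hI t).continuousAt
  have hWc : Continuous W := continuous_iff_continuousAt.2 fun t => (hW t).continuousAt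
  have hanti : AntitoneOn G (Set.Icc 0 T) := by
    refine antitoneOn_of_hasDerivWithinAt_nonpos (convex_Icc 0 T)
      (((Real.continuous_exp.comp (continuous_const.mul hIc)).continuousOn).mul
        ((hcont.pow 2).sub hWc.continuousOn))
      (f' := fun t => Real.exp (k * I t) * (k * (b t) ^ (2 * L - 2)) * (ρ t ^ 2 - W t) +
        Real.exp (k * I t) * (E' t - c ^ 2 * (-(lam * (-(2 * (2 * L - 2)))) *
      (b t) ^ (-(2 * (2 * L - 2)))))) (fun t ht => ?_) (fun t ht => ?_)
    · rw [interior_Icc] at ht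
      exact ((((hI t).const_mul k).exp).mul ((hderiv t ht).sub (hW t))).hasDerivWithinAt
    · rw [interior_Icc] at ht
      have h1 := hE' t ht
      set B := (b t) ^ (2 * L - 2) with hB
      have hBpos : 0 < B := Real.rpow_pos_of_pos (hpos t) _
      have hBW : (b t) ^ (-(2 * (2 * L - 2))) = (B ^ 2)⁻¹ := by
        rw [Real.rpow_neg (hpos t).le, mul_comm (2 : ℝ), Real.rpow_mul (hpos t).le, Real.rpow_two]
      have h2 : 0 ≤ c ^ 2 * (-(lam * (-(2 * (2 * L - 2)))) * (b t) ^ (-(2 * (2 * L - 2)))) := by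
        have : 0 ≤ -(lam * (-(2 * (2 * L - 2)))) := by nlinarith
        have := Real.rpow_nonneg (hpos t).le (-(2 * (2 * L - 2)))
        positivity
      have h3 : 2 * (lam * L * Y) * ρ t - k * B * ρ t ^ 2 - k * B * W t ≤ 0 := by
        have h4 : 2 * (lam * L * Y) * ρ t - k * B * ρ t ^ 2 - k * B * W t
            = -(k * B) * (ρ t - c * B⁻¹) ^ 2 := by
          simp only [W, hBW, c]; field_simp; ring
        rw [h4]
        have : 0 ≤ k * B * (ρ t - c * B⁻¹) ^ 2 := by positivity
        linarith
      rw [mul_assoc, ← mul_add]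
      exact mul_nonpos_of_nonneg_of_nonpos (Real.exp_pos _).le (by nlinarith)
  have h0 : (0 : ℝ) ∈ Set.Icc 0 T := ⟨le_rfl, ht.1.trans ht.2⟩
  have h1 := hanti h0 ht ht.1
  have hW0 : 0 ≤ W 0 := mul_nonneg (sq_nonneg _) (Real.rpow_nonneg (hpos 0).le _)
  have h2 : G 0 ≤ Y ^ 2 := by
    have : ρ 0 ^ 2 ≤ Y ^ 2 := pow_le_pow_left₀ (hρ 0) hρ0 2
    simp only [G, hI0, mul_zero, Real.exp_zero, one_mul]
    linarith
  have h3 : ρ t ^ 2 ≤ Y ^ 2 * Real.exp (-(k * I t)) + W t := by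
    have h4 : Real.exp (k * I t) * (ρ t ^ 2 - W t) ≤ Y ^ 2 := h1.trans h2
    rw [Real.exp_neg, ← div_eq_mul_inv]
    have := (le_div_iff₀' (Real.exp_pos (k * I t))).2 h4
    linarith
  have hWt : W t = (c * (b t) ^ (-(2 * L - 2))) ^ 2 := by
    simp only [W]
    rw [mul_pow c, ← Real.rpow_mul_natCast (hpos t).le]
    congr 2
    push_cast; ring
  have hex : Real.exp (-(k * I t)) = Real.exp (-(k / 2) * I t) ^ 2 := by
    rw [← Real.exp_nat_mul]; congr 1; push_cast; ring
  have hq : 0 ≤ c * (b t) ^ (-(2 * L - 2)) := mul_nonneg hc (Real.rpow_nonneg (hpos t).le _)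
  refine abs_le_of_sq_le_sq' ?_ (by positivity) |>.2
  rw [hWt, hex] at h3
  have : 0 ≤ Y * Real.exp (-(k / 2) * I t) * (c * (b t) ^ (-(2 * L - 2))) := by positivity
  nlinarith

/-- A curve whose speed is controlled by `(α e^{-lam t})^(L - 2) ρ` stays within a multiple of
`(α e^{-lam t})^(-L)` of its starting point. -/
theorem norm_le_of_norm_deriv_le {V : Type*} [NormedAddCommGroup V] [NormedSpace ℝ V]
    {L lam α k Y T C : ℝ} (hL : 1 ≤ L) (hlam : 0 < lam) (hα : 0 < α)
    (hk : 0 < k) (hY : 0 ≤ Y) (hC : 0 ≤ C) {I ρ : ℝ → ℝ} (hI0 : I 0 = 0)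
    (hI : ∀ t, HasDerivAt I ((α * Real.exp (-(lam * t))) ^ (2 * L - 2)) t)
    (hρ : ∀ t ∈ Set.Icc 0 T, ρ t ≤ Y * Real.exp (-(k / 2) * I t) +
      L * Y / k * lam * (α * Real.exp (-(lam * t))) ^ (-(2 * L - 2)))
    {ψ ψ' : ℝ → V} (hψ0 : ψ 0 = 0) (hcont : ContinuousOn ψ (Set.Icc 0 T))
    (hderiv : ∀ t ∈ Set.Ico 0 T, HasDerivWithinAt ψ (ψ' t) (Set.Ici t) t)
    (hbound : ∀ t ∈ Set.Ico 0 T, ‖ψ' t‖ ≤ C * (α * Real.exp (-(lam * t))) ^ (L - 2) * ρ t)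
    {t : ℝ} (ht : t ∈ Set.Icc 0 T) :
    ‖ψ t‖ ≤ C * (3 * Y / k) * (α * Real.exp (-(lam * t))) ^ (-L) := by
  have hpos : ∀ t, 0 < α * Real.exp (-(lam * t)) := fun t => by positivity
  have hImono : Monotone I := monotone_of_deriv_nonneg (fun t => (hI t).differentiableAt)
    fun t => by rw [(hI t).deriv]; exact Real.rpow_nonneg (hpos t).le _
  set b : ℝ → ℝ := fun t => α * Real.exp (-(lam * t)) with hb
  let e : ℝ → ℝ := fun t => Real.exp (-(k / 2) * I t)
  have he : ∀ t, HasDerivAt e (Real.exp (-(k / 2) * I t) *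
      (-(k / 2) * (b t) ^ (2 * L - 2))) t := fun t => ((hI t).const_mul _).exp
  have hg : ∀ t, HasDerivAt (fun t => C * ((b t) ^ (-L) * (3 * Y / k - 2 * Y / k * e t)))
      (C * (-(lam * -L) * (b t) ^ (-L) * (3 * Y / k - 2 * Y / k * e t) + (b t) ^ (-L) *
        (-(2 * Y / k * (Real.exp (-(k / 2) * I t) * (-(k / 2) * (b t) ^ (2 * L - 2))))))) t :=
    fun t => ((hasDerivAt_const_mul_exp_rpow hα lam (-L) t).mul
      (((he t).const_mul (2 * Y / k)).const_sub _)).const_mul C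
  -- In the derivative of this barrier, the term from `e` reproduces the transient `b^(L-2) Y e`;
  -- the coefficient `2` offsets the rate `k / 2`. The growth of `b^(-L)` must pay for the forced
  -- part, and `3 = 2 + 1` keeps the bracket at least `Y / k` because `e ≤ 1`.
  have hle := image_norm_le_of_norm_deriv_right_le_deriv_boundary hcont hderiv
    (B := fun t => C * ((b t) ^ (-L) * (3 * Y / k - 2 * Y / k * e t))) ?_ hg ?_ ht
  · refine hle.trans ?_
    have h1 : 0 ≤ (b t) ^ (-L) := Real.rpow_nonneg (hpos t).le _
    have h2 : 0 ≤ 2 * Y / k * e t := by positivity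
    rw [mul_assoc, mul_comm (3 * Y / k)]
    gcongr
    linarith
  · have h1 : 0 ≤ (b 0) ^ (-L) := Real.rpow_nonneg (hpos 0).le _
    have h2 : 3 * Y / k - 2 * Y / k * e 0 = Y / k := by
      simp only [e, hI0, mul_zero, Real.exp_zero]; ring
    rw [hψ0, norm_zero, h2]
    positivity
  · intro s hs
    have hp1 : (b s) ^ (-L) * (b s) ^ (2 * L - 2) = (b s) ^ (L - 2) := by
      rw [← Real.rpow_add (hpos s)]; congr 1; ring
    have hp2 : (b s) ^ (L - 2) * (b s) ^ (-(2 * L - 2)) = (b s) ^ (-L) := by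
      rw [← Real.rpow_add (hpos s)]; congr 1; ring
    have he1 : e s ≤ 1 := by
      have : 0 ≤ I s := hI0 ▸ hImono hs.1
      exact Real.exp_le_one_iff.2 (by nlinarith)
    have h1 : 0 ≤ (b s) ^ (-L) := Real.rpow_nonneg (hpos s).le _
    have h2 : 0 ≤ (b s) ^ (L - 2) := Real.rpow_nonneg (hpos s).le _
    refine (hbound s hs).trans ?_
    rw [mul_assoc]
    refine mul_le_mul_of_nonneg_left ?_ hC
    have h3 := mul_le_mul_of_nonneg_left (hρ s (Set.Ico_subset_Icc_self hs)) h2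
    refine h3.trans ?_
    have h4 : (b s) ^ (L - 2) * (Y * Real.exp (-(k / 2) * I s) +
        L * Y / k * lam * (b s) ^ (-(2 * L - 2))) =
        (b s) ^ (L - 2) * (Y * e s) + L * Y / k * lam * (b s) ^ (-L) := by
      rw [← hp2]; ring
    have h5 : -(lam * -L) * (b s) ^ (-L) * (3 * Y / k - 2 * Y / k * e s) + (b s) ^ (-L) *
        (-(2 * Y / k * (Real.exp (-(k / 2) * I s) * (-(k / 2) * (b s) ^ (2 * L - 2))))) =
        lam * L * (b s) ^ (-L) * (3 * Y / k - 2 * Y / k * e s) + (b s) ^ (L - 2) * (Y * e s) := by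
      rw [← hp1]; simp only [e]; field_simp
    rw [h4, h5]
    have h6 : Y / k ≤ 3 * Y / k - 2 * Y / k * e s := by
      have : 2 * Y / k * e s ≤ 2 * Y / k := mul_le_of_le_one_right (by positivity) he1
      have h7 : 3 * Y / k = 2 * Y / k + Y / k := by ring
      linarith
    have h8 := mul_le_mul_of_nonneg_left h6 (show 0 ≤ lam * L * (b s) ^ (-L) by positivity)
    have h9 : L * Y / k * lam * (b s) ^ (-L) = lam * L * (b s) ^ (-L) * (Y / k) := by ring
    linarith

/-- A continuous function that cannot reach `ε` before being shown to be smaller stays below. -/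
theorem forall_lt_of_forall_Ico_le {u : ℝ → ℝ} {ε T : ℝ} (hu : ContinuousOn u (Set.Icc 0 T))
    (h : ∀ τ ∈ Set.Icc 0 T, (∀ s ∈ Set.Ico 0 τ, u s ≤ ε) → u τ < ε) :
    ∀ t ∈ Set.Icc 0 T, u t < ε := by
  intro t ht
  by_contra! hcon
  have hK : IsCompact (Set.Icc 0 T ∩ u ⁻¹' Set.Ici ε) :=
    isCompact_Icc.of_isClosed_subset (hu.preimage_isClosed_of_isClosed isClosed_Icc isClosed_Ici)
      Set.inter_subset_left
  obtain ⟨τ, ⟨hτ, hτε⟩, hmin⟩ := hK.exists_isLeast ⟨t, ht, hcon⟩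
  refine absurd (h τ hτ fun s hs => ?_) (not_lt.2 hτε)
  by_contra! hs'
  exact absurd (hmin ⟨⟨hs.1, hs.2.le.trans hτ.2⟩, hs'.le⟩) (not_le.2 hs.2)

/-! ### Euler's identity and conditioning of the features. -/

/-- Euler's identity for homogeneous models. -/
theorem IsHomogeneousModel.inner_ntkFeature_self {f : EuclideanSpace ℝ (Fin D) → X → ℝ} {L : ℝ}
    (hhom : IsHomogeneousModel f L) (hdiff : ∀ x : X, Differentiable ℝ (fun θ => f θ x))
    (θ : EuclideanSpace ℝ (Fin D)) (x : X) : inner ℝ (ntkFeature f θ x) θ = L * f θ x := by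
  have h1 : HasDerivAt (fun c : ℝ => c • θ) ((1 : ℝ) • θ) 1 := (hasDerivAt_id (1 : ℝ)).smul_const θ
  have h2 : HasFDerivAt (fun ϑ => f ϑ x)
      (InnerProductSpace.toDual ℝ _ (ntkFeature f θ x)) ((1 : ℝ) • θ) := by
    rw [one_smul]; exact (hdiff x θ).hasGradientAt.hasFDerivAt
  have h3 := h2.comp_hasDerivAt 1 h1
  have h4 : HasDerivAt (fun c : ℝ => c ^ L * f θ x) (L * f θ x) 1 := by
    simpa using (Real.hasDerivAt_rpow_const (x := 1) (p := L) (Or.inl one_ne_zero)).mul_const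
      (f θ x)
  have h5 : (fun c : ℝ => c ^ L * f θ x) =ᶠ[𝓝 1] (fun ϑ => f ϑ x) ∘ fun c : ℝ => c • θ := by
    filter_upwards [lt_mem_nhds (zero_lt_one' ℝ)] with c hc
    exact (hhom x c hc θ).symm
  have h6 := (h3.congr_of_eventuallyEq h5).unique h4
  simpa using h6

/-- The combination `∑ᵢ rᵢ ∇f(θ; xᵢ)` of the features. -/
noncomputable def featureSum (f : EuclideanSpace ℝ (Fin D) → X → ℝ) (x : Fin n → X)
    (θ : EuclideanSpace ℝ (Fin D)) (r : Fin n → ℝ) : EuclideanSpace ℝ (Fin D) :=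
  ∑ i, r i • ntkFeature f θ (x i)

theorem norm_featureSum_sub_le (f : EuclideanSpace ℝ (Fin D) → X → ℝ) (x : Fin n → X)
    (θ θ' : EuclideanSpace ℝ (Fin D)) (r : Fin n → ℝ) :
    ‖featureSum f x θ r - featureSum f x θ' r‖ ≤
      √(∑ i, ‖ntkFeature f θ (x i) - ntkFeature f θ' (x i)‖ ^ 2) * √(∑ i, r i ^ 2) := by
  unfold featureSum
  rw [← Finset.sum_sub_distrib]
  calc ‖∑ i, (r i • ntkFeature f θ (x i) - r i • ntkFeature f θ' (x i))‖
      ≤ ∑ i, ‖ntkFeature f θ (x i) - ntkFeature f θ' (x i)‖ * |r i| := by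
        refine norm_sum_le_of_le _ fun i _ => ?_
        rw [← smul_sub, norm_smul, mul_comm, Real.norm_eq_abs]
    _ ≤ _ := by
        refine (Real.sum_mul_le_sqrt_mul_sqrt _ _ _).trans ?_
        simp only [sq_abs]; exact le_rfl

/-- `δ` is uniform in `r`, so the estimate applies to the moving residual. It serves both the
conditioning near `θ₀` and the smallness of the component orthogonal to the span. -/
theorem exists_norm_featureSum_sub_le {f : EuclideanSpace ℝ (Fin D) → X → ℝ}
    (hsmooth : ∀ x : X, ContDiff ℝ 2 (fun θ => f θ x)) (x : Fin n → X)
    (θ₀ : EuclideanSpace ℝ (Fin D)) {η : ℝ} (hη : 0 < η) :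
    ∃ δ > 0, ∀ θ, ‖θ - θ₀‖ ≤ δ → ∀ r : Fin n → ℝ,
      ‖featureSum f x θ r - featureSum f x θ₀ r‖ ≤ η * √(∑ i, r i ^ 2) := by
  have hc : Continuous fun θ => √(∑ i, ‖ntkFeature f θ (x i) - ntkFeature f θ₀ (x i)‖ ^ 2) :=
    Real.continuous_sqrt.comp (continuous_finsetSum _ fun i _ =>
      (((continuous_ntkFeature hsmooth (x i)).sub continuous_const).norm.pow 2))
  have h := (hc.tendsto θ₀).eventually (eventually_lt_nhds (show _ < η by simpa using hη))
  obtain ⟨δ, hδ, hball⟩ := Metric.nhds_basis_closedBall.eventually_iff.1 h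
  refine ⟨δ, hδ, fun θ hθ r => (norm_featureSum_sub_le f x θ θ₀ r).trans ?_⟩
  gcongr
  exact (hball (by simpa [dist_eq_norm] using hθ)).le

/-- Near parameters with independent features, feature combinations are comparable to their
coefficients. -/
theorem exists_norm_featureSum_bounds {f : EuclideanSpace ℝ (Fin D) → X → ℝ}
    (hsmooth : ∀ x : X, ContDiff ℝ 2 (fun θ => f θ x)) (x : Fin n → X)
    (θ₀ : EuclideanSpace ℝ (Fin D))
    (hindep : LinearIndependent ℝ (fun i => ntkFeature f θ₀ (x i))) :
    ∃ ε > 0, ∃ κ > 0, ∃ M ≥ 0, ∀ θ, ‖θ - θ₀‖ ≤ ε → ∀ r : Fin n → ℝ,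
      κ * √(∑ i, r i ^ 2) ≤ ‖featureSum f x θ r‖ ∧
      ‖featureSum f x θ r‖ ≤ M * √(∑ i, r i ^ 2) := by
  let Λ : EuclideanSpace ℝ (Fin n) →ₗ[ℝ] EuclideanSpace ℝ (Fin D) :=
    (Fintype.linearCombination ℝ fun i => ntkFeature f θ₀ (x i)) ∘ₗ
      (WithLp.linearEquiv 2 ℝ (Fin n → ℝ)).toLinearMap
  have hΛ : ∀ r : Fin n → ℝ, Λ (WithLp.toLp 2 r) = featureSum f x θ₀ r := fun r => rfl
  have hnorm : ∀ r : Fin n → ℝ, ‖(WithLp.toLp 2 r : EuclideanSpace ℝ (Fin n))‖ =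
      √(∑ i, r i ^ 2) := fun r => by simp [EuclideanSpace.norm_eq]
  have hker : LinearMap.ker Λ = ⊥ := by
    rw [LinearMap.ker_eq_bot, LinearMap.coe_comp]
    exact (linearIndependent_iff_injective_fintypeLinearCombination.1 hindep).comp
      (WithLp.linearEquiv 2 ℝ (Fin n → ℝ)).injective
  obtain ⟨K, hK, hanti⟩ := Λ.exists_antilipschitzWith hker
  have hK' : (0 : ℝ) < K := hK
  -- The perturbation may cost at most half of the lower bound `K⁻¹` valid at `θ₀`.
  obtain ⟨ε, hε, hclose⟩ := exists_norm_featureSum_sub_le hsmooth x θ₀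
    (η := (K : ℝ)⁻¹ / 2) (by positivity)
  refine ⟨ε, hε, (K : ℝ)⁻¹ / 2, by positivity, ‖Λ.toContinuousLinearMap‖ + (K : ℝ)⁻¹ / 2,
    by positivity, fun θ hθ r => ?_⟩
  have h1 := hclose θ hθ r
  have h2 : √(∑ i, r i ^ 2) ≤ K * ‖featureSum f x θ₀ r‖ := by
    rw [← hnorm, ← hΛ]
    exact hanti.le_mul_norm (map_zero Λ) _
  have h2' : (K : ℝ)⁻¹ * √(∑ i, r i ^ 2) ≤ ‖featureSum f x θ₀ r‖ := by
    rwa [inv_mul_le_iff₀ hK']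
  have h3 : ‖featureSum f x θ₀ r‖ ≤ ‖Λ.toContinuousLinearMap‖ * √(∑ i, r i ^ 2) := by
    rw [← hnorm, ← hΛ]
    exact Λ.toContinuousLinearMap.le_opNorm _
  have h4 := norm_le_norm_add_norm_sub' (featureSum f x θ₀ r) (featureSum f x θ r)
  have h5 := norm_le_norm_add_norm_sub' (featureSum f x θ r) (featureSum f x θ₀ r)
  rw [norm_sub_rev] at h4
  constructor <;> linarith

theorem IsHomogeneousModel.featureSum_smul {f : EuclideanSpace ℝ (Fin D) → X → ℝ} {L : ℝ}
    (hhom : IsHomogeneousModel f L) (hdiff : ∀ x : X, Differentiable ℝ (fun θ => f θ x))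
    {c : ℝ} (hc : 0 < c) (x : Fin n → X) (θ : EuclideanSpace ℝ (Fin D)) (r : Fin n → ℝ) :
    featureSum f x (c • θ) r = c ^ (L - 1) • featureSum f x θ r := by
  unfold featureSum
  rw [Finset.smul_sum]
  refine Finset.sum_congr rfl fun i _ => ?_
  rw [hhom.ntkFeature_smul hdiff hc, smul_comm]

/-! ### Evolution laws and bounds along the flow. -/

section Trajectory

variable {f : EuclideanSpace ℝ (Fin D) → X → ℝ} {L : ℝ} {x : Fin n → X} {y : Fin n → ℝ}
  {lam α : ℝ} {θ₀ : EuclideanSpace ℝ (Fin D)} {θ : ℝ → EuclideanSpace ℝ (Fin D)}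

/-- Along the flow, `φ = θ / (α e^{-lam t})` moves only through the data term. -/
theorem hasDerivWithinAt_rescaled_gradientFlow (hhom : IsHomogeneousModel f L)
    (hdiff : ∀ x : X, Differentiable ℝ (fun θ => f θ x)) (hα : 0 < α)
    (hθ : IsGradientFlow (regLoss f x y lam) (α • θ₀) θ) {t : ℝ} (ht : 0 ≤ t) :
    HasDerivWithinAt (fun t => (α * Real.exp (-(lam * t)))⁻¹ • θ t)
      (-((2 / (n : ℝ) * (α * Real.exp (-(lam * t))) ^ (L - 2)) •
        featureSum f x ((α * Real.exp (-(lam * t)))⁻¹ • θ t) fun i => f (θ t) (x i) - y i))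
      (Set.Ici 0) t := by
  have hpos : 0 < α * Real.exp (-(lam * t)) := by positivity
  have h1 := hθ.2 t ht
  rw [gradient_regLoss hdiff] at h1
  have h2 : HasDerivAt (fun t => (α * Real.exp (-(lam * t)))⁻¹)
      (lam * (α * Real.exp (-(lam * t)))⁻¹) t := by
    have := hasDerivAt_const_mul_exp_rpow hα lam (-1) t
    simpa [Real.rpow_neg_one] using this
  refine (h2.hasDerivWithinAt.smul h1).congr_deriv ?_
  have h3 : ∑ i, (f (θ t) (x i) - y i) • ntkFeature f (θ t) (x i) =
      (α * Real.exp (-(lam * t))) ^ (L - 1) •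
        featureSum f x ((α * Real.exp (-(lam * t)))⁻¹ • θ t) fun i => f (θ t) (x i) - y i := by
    rw [← hhom.featureSum_smul hdiff hpos, smul_inv_smul₀ hpos.ne']
    rfl
  rw [h3]
  have h4 : (α * Real.exp (-(lam * t))) ^ (L - 2) =
      (α * Real.exp (-(lam * t)))⁻¹ * (α * Real.exp (-(lam * t))) ^ (L - 1) := by
    rw [← Real.rpow_neg_one, ← Real.rpow_add hpos]; congr 1; ring
  rw [h4]
  -- The weight decay term cancels against the derivative of the factor `b⁻¹`.
  module

/-- Evolution of the squared residual along the flow. -/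
theorem hasDerivAt_sum_residual_sq (hhom : IsHomogeneousModel f L)
    (hdiff : ∀ x : X, Differentiable ℝ (fun θ => f θ x)) {z₀ : EuclideanSpace ℝ (Fin D)}
    (hθ : IsGradientFlow (regLoss f x y lam) z₀ θ) {t : ℝ} (ht : 0 < t) :
    HasDerivAt (fun t => ∑ i, (f (θ t) (x i) - y i) ^ 2)
      (-(4 / (n : ℝ)) * ‖featureSum f x (θ t) fun i => f (θ t) (x i) - y i‖ ^ 2 -
        2 * (lam * L) * ∑ i, (f (θ t) (x i) - y i) * f (θ t) (x i)) t := by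
  have h1 := (hθ.2 t ht.le).hasDerivAt (Ici_mem_nhds ht)
  rw [gradient_regLoss hdiff] at h1
  set r : Fin n → ℝ := fun i => f (θ t) (x i) - y i with hr
  have hJ : ∑ i, (f (θ t) (x i) - y i) • ntkFeature f (θ t) (x i) = featureSum f x (θ t) r := rfl
  rw [hJ] at h1
  have h2 : ∀ i, HasDerivAt (fun t => (f (θ t) (x i) - y i) ^ 2) (2 * r i *
      (-(2 / (n : ℝ)) * inner ℝ (ntkFeature f (θ t) (x i)) (featureSum f x (θ t) r) -
        lam * L * f (θ t) (x i))) t := by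
    intro i
    have h3 := (((hdiff (x i) (θ t)).hasGradientAt.hasFDerivAt.comp_hasDerivAt t h1).sub_const
      (y i)).pow 2
    refine h3.congr_deriv ?_
    rw [InnerProductSpace.toDual_apply_apply]
    -- Euler's identity turns the weight decay contribution into a multiple of the model output.
    have h4 : inner ℝ (gradient (fun θ => f θ (x i)) (θ t)) (θ t) = L * f (θ t) (x i) :=
      hhom.inner_ntkFeature_self hdiff (θ t) (x i)
    rw [inner_neg_right, inner_add_right, inner_smul_right, inner_smul_right, h4]
    simp only [hr, ntkFeature, Function.comp]
    push_cast
    ring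
  refine (HasDerivAt.fun_sum fun i (_ : i ∈ Finset.univ) => h2 i).congr_deriv ?_
  have h5 : ‖featureSum f x (θ t) r‖ ^ 2 =
      ∑ i, r i * inner ℝ (ntkFeature f (θ t) (x i)) (featureSum f x (θ t) r) := by
    rw [← real_inner_self_eq_norm_sq]
    conv_lhs => enter [2]; unfold featureSum
    rw [sum_inner]
    exact Finset.sum_congr rfl fun i _ => real_inner_smul_left _ _ _
  rw [h5, Finset.mul_sum, Finset.mul_sum, ← Finset.sum_sub_distrib]
  refine Finset.sum_congr rfl fun i _ => ?_
  simp only [hr]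
  ring

end Trajectory

section Trajectory

variable {f : EuclideanSpace ℝ (Fin D) → X → ℝ} {L : ℝ} {x : Fin n → X} {y : Fin n → ℝ}
  {lam α : ℝ} {θ₀ : EuclideanSpace ℝ (Fin D)} {θ : ℝ → EuclideanSpace ℝ (Fin D)}

/-- As long as the rescaled flow stays where the features are well conditioned, the residual obeys
the comparison estimate. -/
theorem residual_le_of_forall_norm_sub_le (hn : 0 < n) (hL : 1 ≤ L)
    (hhom : IsHomogeneousModel f L)
    (hdiff : ∀ x : X, Differentiable ℝ (fun θ => f θ x)) (hzero : ∀ i, f θ₀ (x i) = 0)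
    (hlam : 0 < lam) (hα : 0 < α)
    (hθ : IsGradientFlow (regLoss f x y lam) (α • θ₀) θ) {ε κ : ℝ} (hκ : 0 < κ)
    (hlow : ∀ ϑ, ‖ϑ - θ₀‖ ≤ ε → ∀ r : Fin n → ℝ, κ * √(∑ i, r i ^ 2) ≤ ‖featureSum f x ϑ r‖)
    {I : ℝ → ℝ} (hI0 : I 0 = 0)
    (hI : ∀ t, HasDerivAt I ((α * Real.exp (-(lam * t))) ^ (2 * L - 2)) t) {τ : ℝ}
    (hball : ∀ t ∈ Set.Ico 0 τ, ‖(α * Real.exp (-(lam * t)))⁻¹ • θ t - θ₀‖ ≤ ε)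
    {t : ℝ} (ht : t ∈ Set.Icc 0 τ) :
    √(∑ i, (f (θ t) (x i) - y i) ^ 2) ≤
      √(∑ i, y i ^ 2) * Real.exp (-((2 / (n : ℝ) * κ ^ 2) / 2) * I t) +
      L * √(∑ i, y i ^ 2) / (2 / (n : ℝ) * κ ^ 2) * lam *
        (α * Real.exp (-(lam * t))) ^ (-(2 * L - 2)) := by
  have hn' : (0 : ℝ) < n := by exact_mod_cast hn
  have hθc : ContinuousOn θ (Set.Icc 0 τ) := fun s hs =>
    ((hθ.2 s hs.1).continuousWithinAt).mono Set.Icc_subset_Ici_self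
  have hsq : ∀ t, √(∑ i, (f (θ t) (x i) - y i) ^ 2) ^ 2 = ∑ i, (f (θ t) (x i) - y i) ^ 2 :=
    fun t => Real.sq_sqrt (Finset.sum_nonneg fun i _ => sq_nonneg _)
  refine le_of_hasDerivAt_sq_le (ρ := fun t => √(∑ i, (f (θ t) (x i) - y i) ^ 2)) (T := τ)
    (E' := fun t => -(4 / (n : ℝ)) * ‖featureSum f x (θ t) fun i => f (θ t) (x i) - y i‖ ^ 2 -
        2 * (lam * L) * ∑ i, (f (θ t) (x i) - y i) * f (θ t) (x i)) hL hlam hα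
    (by positivity) (Real.sqrt_nonneg _) hI0 hI ?_ (fun t => Real.sqrt_nonneg _) ?_ ?_ ?_ ht
  · have h1 : ∀ i, f (θ 0) (x i) = 0 := fun i => by
      rw [hθ.1, hhom _ _ hα, hzero, mul_zero]
    simp [h1]
  · exact Real.continuous_sqrt.comp_continuousOn (continuousOn_finsetSum _ fun i _ =>
      (((hdiff (x i)).continuous.comp_continuousOn hθc).sub continuousOn_const).pow 2)
  · intro s hs
    simp only [hsq]
    exact hasDerivAt_sum_residual_sq hhom hdiff hθ hs.1
  · intro s hs
    have hpos : 0 < α * Real.exp (-(lam * s)) := by positivity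
    set b := α * Real.exp (-(lam * s)) with hb
    set r : Fin n → ℝ := fun i => f (θ s) (x i) - y i with hr
    have hJ : ‖featureSum f x (θ s) r‖ ^ 2 =
        b ^ (2 * L - 2) * ‖featureSum f x (b⁻¹ • θ s) r‖ ^ 2 := by
      conv_lhs => rw [← smul_inv_smul₀ hpos.ne' (θ s)]
      rw [hhom.featureSum_smul hdiff hpos, norm_smul, mul_pow,
        Real.norm_of_nonneg (Real.rpow_nonneg hpos.le _), ← Real.rpow_mul_natCast hpos.le]
      congr 2
      push_cast; ring
    have h1 := hlow _ (hball s ⟨hs.1.le, hs.2⟩) r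
    have h2 : κ ^ 2 * √(∑ i, r i ^ 2) ^ 2 ≤ ‖featureSum f x (b⁻¹ • θ s) r‖ ^ 2 := by
      rw [← mul_pow]
      exact pow_le_pow_left₀ (by positivity) h1 2
    -- With `f = r + y`, the sum is `∑ r² + ∑ r y`; the square is dropped and Cauchy–Schwarz bounds
    -- the rest.
    have h3 : -(√(∑ i, r i ^ 2) * √(∑ i, y i ^ 2)) ≤ ∑ i, r i * f (θ s) (x i) := by
      have h4 := Real.sum_mul_le_sqrt_mul_sqrt Finset.univ r (fun i => -y i)
      simp only [neg_sq] at h4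
      have h5 : ∑ i, r i * f (θ s) (x i) = ∑ i, r i ^ 2 - ∑ i, r i * -y i := by
        rw [← Finset.sum_sub_distrib]
        exact Finset.sum_congr rfl fun i _ => by simp only [hr]; ring
      have h6 : 0 ≤ ∑ i, r i ^ 2 := Finset.sum_nonneg fun i _ => sq_nonneg _
      linarith
    have hB : 0 ≤ b ^ (2 * L - 2) := Real.rpow_nonneg hpos.le _
    have h7 := mul_le_mul_of_nonneg_left h2 (show 0 ≤ 4 / (n : ℝ) * b ^ (2 * L - 2) by positivity)
    have h8 := mul_le_mul_of_nonneg_left h3 (show 0 ≤ 2 * (lam * L) by positivity)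
    rw [hJ]
    have h9 : 2 * (2 / (n : ℝ) * κ ^ 2) * b ^ (2 * L - 2) * √(∑ i, r i ^ 2) ^ 2 =
        4 / (n : ℝ) * b ^ (2 * L - 2) * (κ ^ 2 * √(∑ i, r i ^ 2) ^ 2) := by ring
    linarith

/-- A linear image of the displacement of the rescaled flow is controlled by the size of that
linear map on the feature combinations met along the way. -/
theorem norm_map_rescaled_sub_le (hn : 0 < n) (hL : 1 ≤ L) (hhom : IsHomogeneousModel f L)
    (hdiff : ∀ x : X, Differentiable ℝ (fun θ => f θ x))
    (hlam : 0 < lam) (hα : 0 < α)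
    (hθ : IsGradientFlow (regLoss f x y lam) (α • θ₀) θ) {k η : ℝ} (hk : 0 < k) (hη : 0 ≤ η)
    {I : ℝ → ℝ} (hI0 : I 0 = 0)
    (hI : ∀ t, HasDerivAt I ((α * Real.exp (-(lam * t))) ^ (2 * L - 2)) t) {τ : ℝ}
    (P : EuclideanSpace ℝ (Fin D) →L[ℝ] EuclideanSpace ℝ (Fin D))
    (hres : ∀ t ∈ Set.Icc 0 τ, √(∑ i, (f (θ t) (x i) - y i) ^ 2) ≤
      √(∑ i, y i ^ 2) * Real.exp (-(k / 2) * I t) +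
      L * √(∑ i, y i ^ 2) / k * lam * (α * Real.exp (-(lam * t))) ^ (-(2 * L - 2)))
    (hP : ∀ t ∈ Set.Ico 0 τ, ∀ r : Fin n → ℝ,
      ‖P (featureSum f x ((α * Real.exp (-(lam * t)))⁻¹ • θ t) r)‖ ≤ η * √(∑ i, r i ^ 2))
    {t : ℝ} (ht : t ∈ Set.Icc 0 τ) :
    ‖P ((α * Real.exp (-(lam * t)))⁻¹ • θ t - θ₀)‖ ≤
      2 / (n : ℝ) * η * (3 * √(∑ i, y i ^ 2) / k) * (α * Real.exp (-(lam * t))) ^ (-L) := by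
  have hψ : ∀ t, 0 ≤ t → HasDerivWithinAt
      (fun t => P ((α * Real.exp (-(lam * t)))⁻¹ • θ t - θ₀))
      (P (-((2 / (n : ℝ) * (α * Real.exp (-(lam * t))) ^ (L - 2)) •
        featureSum f x ((α * Real.exp (-(lam * t)))⁻¹ • θ t) fun i => f (θ t) (x i) - y i)))
      (Set.Ici 0) t := fun t ht =>
    P.hasFDerivAt.comp_hasDerivWithinAt t
      ((hasDerivWithinAt_rescaled_gradientFlow hhom hdiff hα hθ ht).sub_const θ₀)
  refine norm_le_of_norm_deriv_le (C := 2 / (n : ℝ) * η) (T := τ) hL hlam hα hk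
    (Real.sqrt_nonneg _) (by positivity) hI0 hI hres
    (ψ := fun t => P ((α * Real.exp (-(lam * t)))⁻¹ • θ t - θ₀)) ?_
    (fun s hs => ((hψ s hs.1).continuousWithinAt).mono Set.Icc_subset_Ici_self)
    (fun s hs => (hψ s hs.1).mono (Set.Ici_subset_Ici.2 hs.1)) ?_ ht
  · simp [hθ.1, smul_smul, inv_mul_cancel₀ hα.ne']
  · intro s hs
    have hpos : 0 < α * Real.exp (-(lam * s)) := by positivity
    have h1 : 0 ≤ (α * Real.exp (-(lam * s))) ^ (L - 2) := Real.rpow_nonneg hpos.le _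
    rw [map_neg, norm_neg, map_smul, norm_smul, Real.norm_of_nonneg (by positivity)]
    have h2 := mul_le_mul_of_nonneg_left (hP s hs fun i => f (θ s) (x i) - y i)
      (show 0 ≤ 2 / (n : ℝ) * (α * Real.exp (-(lam * s))) ^ (L - 2) by positivity)
    refine h2.trans (le_of_eq ?_)
    ring

/-- Bounds on the rescaled flow at a time `T` when the scale `α e^{-lam T}` is still large. -/
theorem rescaled_gradientFlow_bounds (hn : 0 < n) (hL : 1 ≤ L) (hhom : IsHomogeneousModel f L)
    (hdiff : ∀ x : X, Differentiable ℝ (fun θ => f θ x)) (hzero : ∀ i, f θ₀ (x i) = 0)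
    (hlam : 0 < lam) (hα : 0 < α)
    (hθ : IsGradientFlow (regLoss f x y lam) (α • θ₀) θ) {ε κ M : ℝ} (hκ : 0 < κ) (hM : 0 ≤ M)
    (hbounds : ∀ ϑ, ‖ϑ - θ₀‖ ≤ ε → ∀ r : Fin n → ℝ,
      κ * √(∑ i, r i ^ 2) ≤ ‖featureSum f x ϑ r‖ ∧ ‖featureSum f x ϑ r‖ ≤ M * √(∑ i, r i ^ 2))
    {T : ℝ} (hT : 0 ≤ T) (hone : 1 ≤ α * Real.exp (-(lam * T)))
    (hsmall : 2 / (n : ℝ) * M * (3 * √(∑ i, y i ^ 2) / (2 / (n : ℝ) * κ ^ 2)) *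
      (α * Real.exp (-(lam * T))) ^ (-L) < ε) :
    √(∑ i, (f (θ T) (x i) - y i) ^ 2) ≤
      √(∑ i, y i ^ 2) * Real.exp (-((2 / (n : ℝ) * κ ^ 2) / 2) * T) +
      L * √(∑ i, y i ^ 2) / (2 / (n : ℝ) * κ ^ 2) * lam ∧
    ‖(α * Real.exp (-(lam * T)))⁻¹ • θ T - θ₀‖ ≤
      2 / (n : ℝ) * M * (3 * √(∑ i, y i ^ 2) / (2 / (n : ℝ) * κ ^ 2)) *
        (α * Real.exp (-(lam * T))) ^ (-L) ∧
    ∀ (P : EuclideanSpace ℝ (Fin D) →L[ℝ] EuclideanSpace ℝ (Fin D)) (η : ℝ), 0 ≤ η →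
      (∀ ϑ, ‖ϑ - θ₀‖ ≤ 2 / (n : ℝ) * M * (3 * √(∑ i, y i ^ 2) / (2 / (n : ℝ) * κ ^ 2)) *
        (α * Real.exp (-(lam * T))) ^ (-L) → ∀ r : Fin n → ℝ,
        ‖P (featureSum f x ϑ r)‖ ≤ η * √(∑ i, r i ^ 2)) →
      ‖P ((α * Real.exp (-(lam * T)))⁻¹ • θ T - θ₀)‖ ≤
        2 / (n : ℝ) * η * (3 * √(∑ i, y i ^ 2) / (2 / (n : ℝ) * κ ^ 2)) *
          (α * Real.exp (-(lam * T))) ^ (-L) := by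
  have hn' : (0 : ℝ) < n := by exact_mod_cast hn
  set k := 2 / (n : ℝ) * κ ^ 2 with hk
  have hkpos : 0 < k := by positivity
  set A := 2 / (n : ℝ) * M * (3 * √(∑ i, y i ^ 2) / k) with hA
  have hA0 : 0 ≤ A := by positivity
  have hpos : ∀ t, 0 < α * Real.exp (-(lam * t)) := fun t => by positivity
  have hbanti : ∀ {s t : ℝ}, s ≤ t → α * Real.exp (-(lam * t)) ≤ α * Real.exp (-(lam * s)) := by
    intro s t hst
    gcongr
  have hscale : ∀ {t : ℝ}, t ≤ T →
      (α * Real.exp (-(lam * t))) ^ (-L) ≤ (α * Real.exp (-(lam * T))) ^ (-L) := fun ht =>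
    Real.rpow_le_rpow_of_nonpos (hpos T) (hbanti ht) (by linarith)
  have hcB : Continuous fun t : ℝ => (α * Real.exp (-(lam * t))) ^ (2 * L - 2) :=
    continuous_iff_continuousAt.2 fun t =>
      (hasDerivAt_const_mul_exp_rpow hα lam (2 * L - 2) t).continuousAt
  let I : ℝ → ℝ := fun t => ∫ s in (0 : ℝ)..t, (α * Real.exp (-(lam * s))) ^ (2 * L - 2)
  have hI0 : I 0 = 0 := intervalIntegral.integral_same
  have hI : ∀ t, HasDerivAt I ((α * Real.exp (-(lam * t))) ^ (2 * L - 2)) t := fun t =>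
    hcB.integral_hasStrictDerivAt 0 t |>.hasDerivAt
  have hφc : ContinuousOn (fun t => ‖(α * Real.exp (-(lam * t)))⁻¹ • θ t - θ₀‖) (Set.Icc 0 T) :=
    fun s hs => (((hasDerivWithinAt_rescaled_gradientFlow hhom hdiff hα hθ
      hs.1).continuousWithinAt.sub continuousWithinAt_const).norm).mono Set.Icc_subset_Ici_self
  have hstep : ∀ τ, (∀ s ∈ Set.Ico 0 τ, ‖(α * Real.exp (-(lam * s)))⁻¹ • θ s - θ₀‖ ≤ ε) →
      ∀ t ∈ Set.Icc 0 τ, ‖(α * Real.exp (-(lam * t)))⁻¹ • θ t - θ₀‖ ≤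
        A * (α * Real.exp (-(lam * t))) ^ (-L) := by
    intro τ hτ t ht
    exact norm_map_rescaled_sub_le hn hL hhom hdiff hlam hα hθ hkpos hM hI0 hI
      (ContinuousLinearMap.id ℝ _)
      (fun s hs => residual_le_of_forall_norm_sub_le hn hL hhom hdiff hzero hlam hα hθ hκ
        (fun ϑ hϑ r => (hbounds ϑ hϑ r).1) hI0 hI hτ hs)
      (fun s hs r => (hbounds _ (hτ s hs) r).2) ht
  -- Bootstrap: staying within `ε` before `τ` yields the bound `A b^(-L)` at `τ`, which `hsmall`
  -- makes strictly less than `ε`.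
  have hin : ∀ t ∈ Set.Icc 0 T, ‖(α * Real.exp (-(lam * t)))⁻¹ • θ t - θ₀‖ < ε :=
    forall_lt_of_forall_Ico_le hφc fun τ hτ hs =>
      (hstep τ hs τ ⟨hτ.1, le_rfl⟩).trans_lt
        ((mul_le_mul_of_nonneg_left (hscale hτ.2) hA0).trans_lt hsmall)
  have hball : ∀ t ∈ Set.Ico 0 T, ‖(α * Real.exp (-(lam * t)))⁻¹ • θ t - θ₀‖ ≤ ε :=
    fun t ht => (hin t (Set.Ico_subset_Icc_self ht)).le
  have hTT : T ∈ Set.Icc 0 T := ⟨hT, le_rfl⟩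
  have hres := fun s (hs : s ∈ Set.Icc 0 T) =>
    residual_le_of_forall_norm_sub_le hn hL hhom hdiff hzero hlam hα hθ hκ
      (fun ϑ hϑ r => (hbounds ϑ hϑ r).1) hI0 hI hball hs
  refine ⟨(hres T hTT).trans ?_, hstep T hball T hTT, fun P η hη hP => ?_⟩
  -- On `[0, T]` one has `b ≥ 1`, and `2 L - 2 ≥ 0`, so the integrand of `I` is at least `1`.
  · have hIT : T ≤ I T := by
      have h1 : ∫ _ in (0 : ℝ)..T, (1 : ℝ) ≤ I T := by
        refine intervalIntegral.integral_mono_on hT intervalIntegrable_const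
          (hcB.intervalIntegrable 0 T) fun s hs => ?_
        exact Real.one_le_rpow (hone.trans (hbanti hs.2)) (by linarith)
      simpa using h1
    have h2 : (α * Real.exp (-(lam * T))) ^ (-(2 * L - 2)) ≤ 1 :=
      Real.rpow_le_one_of_one_le_of_nonpos hone (by linarith)
    refine add_le_add (mul_le_mul_of_nonneg_left (Real.exp_le_exp.2 ?_) (Real.sqrt_nonneg _))
      (mul_le_of_le_one_right (by positivity) h2)
    nlinarith
  · refine norm_map_rescaled_sub_le hn hL hhom hdiff hlam hα hθ hkpos hη hI0 hI P hres
      (fun s hs r => hP _ ?_ r) hTT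
    exact (hstep T hball s (Set.Ico_subset_Icc_self hs)).trans
      (mul_le_mul_of_nonneg_left (hscale hs.2.le) hA0)

end Trajectory

/-! ### Passage to the limit. -/

/-- Convergence to a vector in the span of `g` can be checked on the inner products with `g` and
on the component orthogonal to the span. -/
theorem tendsto_of_tendsto_inner_of_tendsto_orthogonal {β : Type*} {l : Filter β}
    {g : Fin n → EuclideanSpace ℝ (Fin D)} {u : β → EuclideanSpace ℝ (Fin D)}
    {h : EuclideanSpace ℝ (Fin D)} (hh : h ∈ Submodule.span ℝ (Set.range g))
    (hinner : ∀ i, Tendsto (fun a => inner ℝ (g i) (u a)) l (𝓝 (inner ℝ (g i) h)))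
    (horth : Tendsto (fun a => (Submodule.span ℝ (Set.range g))ᗮ.starProjection (u a)) l (𝓝 0)) :
    Tendsto u l (𝓝 h) := by
  set S := Submodule.span ℝ (Set.range g)
  let Λ : EuclideanSpace ℝ (Fin D) →ₗ[ℝ] EuclideanSpace ℝ (Fin D) × (Fin n → ℝ) :=
    (Sᗮ.starProjection).toLinearMap.prod (LinearMap.pi fun i => (innerSL ℝ (g i)).toLinearMap)
  have hΛ : ∀ w, Λ w = (Sᗮ.starProjection w, fun i => inner ℝ (g i) w) := fun w => rfl
  have hinj : LinearMap.ker Λ = ⊥ := by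
    rw [LinearMap.ker_eq_bot']
    intro w hw
    rw [hΛ, Prod.mk_eq_zero] at hw
    have h1 : w ∈ Sᗮ := (Submodule.mem_orthogonal _ _).2 fun v hv =>
      inner_eq_zero_of_mem_span_range hv fun i => congrFun hw.2 i
    rw [← hw.1, Submodule.starProjection_eq_self_iff.2 h1]
  -- An injective linear map on a finite-dimensional space is an embedding, so convergence can be
  -- tested after applying `Λ`.
  have hind := (LinearMap.isClosedEmbedding_of_injective hinj).isInducing
  rw [hind.tendsto_nhds_iff]
  have hh0 : Sᗮ.starProjection h = 0 := by
    rw [Submodule.starProjection_apply_eq_zero_iff, Submodule.orthogonal_orthogonal]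
    exact hh
  simp only [Function.comp_def, hΛ, hh0]
  exact horth.prodMk_nhds (tendsto_pi_nhds.2 hinner)

/-- Convergence of the weight decay flow in the kernel regime to the kernel predictor. -/
theorem tendsto_model_of_gradientFlow (hn : 0 < n)
    {f : EuclideanSpace ℝ (Fin D) → X → ℝ} {L : ℝ}
    (hhom : IsHomogeneousModel f L)
    (hsmooth : ∀ x : X, ContDiff ℝ 2 (fun θ => f θ x))
    {x : Fin n → X} {y : Fin n → ℝ} {θinit : EuclideanSpace ℝ (Fin D)}
    (hzero : ∀ x' : X, f θinit x' = 0)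
    (hindep : LinearIndependent ℝ (fun i => ntkFeature f θinit (x i)))
    {lam : ℝ → ℝ} (hlam_pos : ∀ α : ℝ, 0 < α → 0 < lam α) (hlam : Tendsto lam atTop (𝓝 0))
    {h : EuclideanSpace ℝ (Fin D)}
    (hspan : h ∈ Submodule.span ℝ (Set.range fun i => ntkFeature f θinit (x i)))
    (hy : ∀ i, inner ℝ (ntkFeature f θinit (x i)) h = y i)
    {θ : ℝ → ℝ → EuclideanSpace ℝ (Fin D)}
    (hθ : ∀ α : ℝ, 0 < α → IsGradientFlow (regLoss f x y (lam α)) (α • θinit) (θ α))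
    {c : ℝ} (hc0 : 0 < c) (hc1 : c < 1) (x' : X) :
    Tendsto (fun α : ℝ => f (θ α ((1 - c) / lam α * Real.log α)) x') atTop
      (𝓝 (inner ℝ (ntkFeature f θinit x') h)) := by
  have hn' : (0 : ℝ) < n := by exact_mod_cast hn
  have hdiff : ∀ x : X, Differentiable ℝ (fun θ => f θ x) :=
    fun x => (hsmooth x).differentiable (by norm_num)
  have hL : 1 ≤ L := hhom.one_le hsmooth (hindep.ne_zero ⟨0, hn⟩)
  obtain ⟨ε, hε, κ, hκ, M, hM, hbounds⟩ := exists_norm_featureSum_bounds hsmooth x θinit hindep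
  set Y := √(∑ i, y i ^ 2) with hY
  set k := 2 / (n : ℝ) * κ ^ 2 with hk
  have hkpos : 0 < k := by positivity
  set A := 2 / (n : ℝ) * M * (3 * Y / k) with hA
  have hA0 : 0 ≤ A := by positivity
  let T : ℝ → ℝ := fun α => (1 - c) / lam α * Real.log α
  let Θ : ℝ → EuclideanSpace ℝ (Fin D) := fun α => θ α (T α)
  let b : ℝ → ℝ := fun α => α * Real.exp (-(lam α * T α))
  let φ : ℝ → EuclideanSpace ℝ (Fin D) := fun α => (b α)⁻¹ • Θ α
  -- The factor `b^L` exactly compensates the displacement bound `A b^(-L)`, so `u` is the bounded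
  -- quantity expected to converge to `h`.
  let u : ℝ → EuclideanSpace ℝ (Fin D) := fun α => (b α) ^ L • (φ α - θinit)
  have hb : ∀ α, 0 < α → b α = α ^ c := by
    intro α hα
    have h1 : lam α * T α = (1 - c) * Real.log α := by
      have := (hlam_pos α hα).ne'
      simp only [T]; field_simp
    have h2 : -((1 - c) * Real.log α) = Real.log α * c - Real.log α := by ring
    simp only [b]
    rw [h1, Real.rpow_def_of_pos hα, h2, Real.exp_sub, Real.exp_log hα]
    field_simp
  have hb_top : Tendsto b atTop atTop := by
    refine (tendsto_rpow_atTop hc0).congr' ?_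
    filter_upwards [eventually_gt_atTop 0] with α hα using (hb α hα).symm
  have hT_top : Tendsto T atTop atTop := by
    have h1 : Tendsto lam atTop (𝓝[>] 0) := tendsto_nhdsWithin_iff.2 ⟨hlam, by
      filter_upwards [eventually_gt_atTop 0] with α hα using hlam_pos α hα⟩
    have h2 : Tendsto (fun α => (1 - c) * (lam α)⁻¹ * Real.log α) atTop atTop :=
      ((tendsto_inv_nhdsGT_zero.comp h1).const_mul_atTop (by linarith)).atTop_mul_atTop₀
        Real.tendsto_log_atTop
    simpa only [T, div_eq_mul_inv] using h2
  have hbL : Tendsto (fun α => A * (b α) ^ (-L)) atTop (𝓝 0) := by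
    simpa using ((tendsto_rpow_neg_atTop (by linarith : 0 < L)).comp hb_top).const_mul A
  have hmain : ∀ᶠ α in atTop,
      √(∑ i, (f (Θ α) (x i) - y i) ^ 2) ≤
        Y * Real.exp (-(k / 2) * T α) + L * Y / k * lam α ∧
      ‖φ α - θinit‖ ≤ A * (b α) ^ (-L) ∧
      ∀ (P : EuclideanSpace ℝ (Fin D) →L[ℝ] EuclideanSpace ℝ (Fin D)) (η : ℝ), 0 ≤ η →
        (∀ ϑ, ‖ϑ - θinit‖ ≤ A * (b α) ^ (-L) → ∀ r : Fin n → ℝ,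
          ‖P (featureSum f x ϑ r)‖ ≤ η * √(∑ i, r i ^ 2)) →
        ‖P (φ α - θinit)‖ ≤ 2 / (n : ℝ) * η * (3 * Y / k) * (b α) ^ (-L) := by
    filter_upwards [eventually_gt_atTop 0, hT_top.eventually_ge_atTop 0,
      hb_top.eventually_ge_atTop 1, hbL.eventually (eventually_lt_nhds hε)] with α hα hT hone hlt
    exact rescaled_gradientFlow_bounds hn hL hhom hdiff (fun i => hzero (x i)) (hlam_pos α hα) hα
      (hθ α hα) hκ hM hbounds hT hone hlt
  have hbpos : ∀ᶠ α in atTop, 0 < b α := hb_top.eventually_gt_atTop 0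
  have hφ : Tendsto φ atTop (𝓝 θinit) := by
    rw [tendsto_iff_norm_sub_tendsto_zero]
    exact squeeze_zero' (Eventually.of_forall fun _ => norm_nonneg _)
      (hmain.mono fun α hα => hα.2.1) hbL
  have hu : ∀ᶠ α in atTop, ‖u α‖ ≤ A := by
    filter_upwards [hmain, hbpos] with α hα hbα
    simp only [u]
    rw [norm_smul, Real.norm_of_nonneg (Real.rpow_nonneg hbα.le _)]
    refine (mul_le_mul_of_nonneg_left hα.2.1 (Real.rpow_nonneg hbα.le _)).trans (le_of_eq ?_)
    rw [mul_left_comm, ← Real.rpow_add hbα, add_neg_cancel, Real.rpow_zero, mul_one]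
  have hmodel : ∀ z : X, Tendsto (fun α => f (Θ α) z - inner ℝ (ntkFeature f θinit z) (u α))
      atTop (𝓝 0) := by
    intro z
    -- The Taylor remainder is `o(‖φ - θinit‖)`; multiplied by `b^L` it is `o(‖u‖)`, hence `o(1)`.
    have h1 := (hasGradientAt_iff_isLittleO.1 (hdiff z θinit).hasGradientAt).comp_tendsto hφ
    have h2 : (fun α => (b α) ^ L * (f (φ α) z - f θinit z -
        inner ℝ (ntkFeature f θinit z) (φ α - θinit))) =o[atTop] u :=
      (((isBigO_refl (fun α => (b α) ^ L) atTop).mul_isLittleO h1.norm_right).congr'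
        EventuallyEq.rfl EventuallyEq.rfl).trans_isBigO
        (IsBigO.of_bound 1 (Eventually.of_forall fun α => by
          simp [u, norm_smul]))
    have h3 : u =O[atTop] (fun _ => (1 : ℝ)) := IsBigO.of_bound A (by simpa using hu)
    refine ((h2.trans_isBigO h3).tendsto_zero_of_tendsto tendsto_const_nhds).congr' ?_
    filter_upwards [hbpos] with α hbα
    have h4 : f (Θ α) z = (b α) ^ L * f (φ α) z := by
      rw [← hhom z (b α) hbα, smul_inv_smul₀ hbα.ne']
    simp only [u]
    rw [h4, hzero, inner_smul_right]
    ring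
  have hres : ∀ i, Tendsto (fun α => f (Θ α) (x i)) atTop (𝓝 (y i)) := by
    have h1 : Tendsto (fun α => Y * Real.exp (-(k / 2) * T α) + L * Y / k * lam α) atTop
        (𝓝 0) := by
      have h2 : Tendsto (fun α => Real.exp (-(k / 2) * T α)) atTop (𝓝 0) :=
        Real.tendsto_exp_atBot.comp (hT_top.const_mul_atTop_of_neg (by linarith))
      simpa using (h2.const_mul Y).add (hlam.const_mul (L * Y / k))
    intro i
    rw [tendsto_iff_norm_sub_tendsto_zero]
    refine squeeze_zero' (Eventually.of_forall fun _ => norm_nonneg _)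
      (hmain.mono fun α hα => le_trans ?_ hα.1) h1
    refine Real.le_sqrt_of_sq_le ?_
    rw [Real.norm_eq_abs, sq_abs]
    exact Finset.single_le_sum (f := fun i => (f (Θ α) (x i) - y i) ^ 2)
      (fun j _ => sq_nonneg _) (Finset.mem_univ i)
  set S := Submodule.span ℝ (Set.range fun i => ntkFeature f θinit (x i)) with hS
  have horth : Tendsto (fun α => Sᗮ.starProjection (u α)) atTop (𝓝 0) := by
    -- The projection kills feature combinations at `θinit`, so nearby it sees only their variation.
    have hP0 : ∀ r, Sᗮ.starProjection (featureSum f x θinit r) = 0 := by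
      intro r
      rw [Submodule.starProjection_apply_eq_zero_iff, Submodule.orthogonal_orthogonal]
      exact Submodule.sum_mem _ fun i _ =>
        Submodule.smul_mem _ _ (Submodule.subset_span ⟨i, rfl⟩)
    rw [NormedAddGroup.tendsto_nhds_zero]
    intro ζ hζ
    set C := 2 / (n : ℝ) * (3 * Y / k) with hC
    have hC0 : 0 ≤ C := by positivity
    -- The `+ 1` gives the strict bound `C * η < ζ` and covers `C = 0`.
    set η := ζ / (C + 1) with hη
    have hη0 : 0 < η := by positivity
    obtain ⟨δ, hδ, hclose⟩ := exists_norm_featureSum_sub_le hsmooth x θinit hη0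
    filter_upwards [hmain, hbpos, hbL.eventually (eventually_le_nhds hδ)] with α hα hbα hsm
    have h1 := hα.2.2 Sᗮ.starProjection η hη0.le fun ϑ hϑ r => by
      have h2 := hclose ϑ (hϑ.trans hsm) r
      have h3 : Sᗮ.starProjection (featureSum f x ϑ r) =
          Sᗮ.starProjection (featureSum f x ϑ r - featureSum f x θinit r) := by
        rw [map_sub, hP0, sub_zero]
      rw [h3]
      exact (Submodule.norm_starProjection_apply_le _ _).trans h2
    simp only [u]
    rw [map_smul, norm_smul, Real.norm_of_nonneg (Real.rpow_nonneg hbα.le _)]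
    have h4 : (b α) ^ L * (2 / (n : ℝ) * η * (3 * Y / k) * (b α) ^ (-L)) = C * η := by
      rw [mul_left_comm, ← Real.rpow_add hbα, add_neg_cancel, Real.rpow_zero, hC]
      ring
    refine (mul_le_mul_of_nonneg_left h1 (Real.rpow_nonneg hbα.le _)).trans_lt ?_
    rw [h4, hη, mul_div_assoc', div_lt_iff₀ (by positivity)]
    nlinarith
  have hinner : ∀ i, Tendsto (fun α => inner ℝ (ntkFeature f θinit (x i)) (u α)) atTop
      (𝓝 (inner ℝ (ntkFeature f θinit (x i)) h)) := by
    intro i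
    rw [hy]
    simpa using (hres i).sub (hmodel (x i))
  have hlim := tendsto_of_tendsto_inner_of_tendsto_orthogonal hspan hinner horth
  have h1 := (hmodel x').add ((tendsto_const_nhds (x := ntkFeature f θinit x')).inner (𝕜 := ℝ) hlim)
  simpa using h1

end HomogeneousModel

theorem mainTheorem3 {D n : ℕ} (hn : 0 < n) {X : Type*}
    (f : EuclideanSpace ℝ (Fin D) → X → ℝ) (L : ℝ)
    (hhom : IsHomogeneousModel f L)
    (hsmooth : ∀ x : X, ContDiff ℝ 2 (fun θ => f θ x))
    (x : Fin n → X) (y : Fin n → ℝ)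
    (θinit : EuclideanSpace ℝ (Fin D))
    (hzero : ∀ x' : X, f θinit x' = 0)
    (hindep : LinearIndependent ℝ (fun i => ntkFeature f θinit (x i)))
    (lam : ℝ → ℝ) (p : ℝ) (hp : 0 < p)
    (hlam_pos : ∀ α : ℝ, 0 < α → 0 < lam α)
    (hlam : lam =Θ[atTop] fun α : ℝ => α ^ (-p)) :
    (∃! h : EuclideanSpace ℝ (Fin D),
        IsMinNormInterpolant (fun i => ntkFeature f θinit (x i)) y h) ∧
    (∀ α : ℝ, 0 < α → ∃ θ : ℝ → EuclideanSpace ℝ (Fin D),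
        IsGradientFlow (regLoss f x y (lam α)) (α • θinit) θ) ∧
    (∀ h : EuclideanSpace ℝ (Fin D),
      IsMinNormInterpolant (fun i => ntkFeature f θinit (x i)) y h →
      ∀ θ : ℝ → ℝ → EuclideanSpace ℝ (Fin D),
        (∀ α : ℝ, 0 < α → IsGradientFlow (regLoss f x y (lam α)) (α • θinit) (θ α)) →
        ∀ c : ℝ, 0 < c → c < 1 → ∀ x' : X,
          Tendsto (fun α : ℝ => f (θ α ((1 - c) / lam α * Real.log α)) x') atTop
            (𝓝 (inner ℝ (ntkFeature f θinit x') h))) := by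
  obtain ⟨h₀, hspan, hmin, huniq⟩ := exists_isMinNormInterpolant hindep y
  refine ⟨⟨h₀, hmin, huniq⟩,
    fun α hα => exists_gradientFlow_regLoss hsmooth x y (hlam_pos α hα) _, ?_⟩
  intro h hh θ hθ c hc0 hc1 x'
  -- Uniqueness places the given minimizer in the span of the features.
  obtain rfl := huniq h hh
  exact tendsto_model_of_gradientFlow hn hhom hsmooth hzero hindep hlam_pos
    (hlam.1.trans_tendsto (tendsto_rpow_neg_atTop hp)) hspan hh.1 hθ hc0 hc1 x'
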